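/- Let $0<q<1$ and let $\mathcal A$ be the coordinate $*$-algebra of the quantum group $SU_q(2)$: the unital complex algebra generated by $a,b,c,d$ with $ab=q\,ba$, $ac=q\,ca$, $bd=q\,db$, $cd=q\,dc$, $bc=cb$, $ad-q\,bc=da-q^{-1}bc=1$ and involution $a^*=d$, $b^*=-qc$, $c^*=-q^{-1}b$, $d^*=a$. Let $h$ be its Haar state, and let $L^2(SU_q(2))$ be the completion of $\mathcal A$ for $\langle y,x\rangle=h(xy^*)$, $\|f\|^2=h(ff^*)$; right multiplication by an element of $\mathcal A$ extends to a bounded operator on $L^2(SU_q(2))$. For $l\in\frac12\mathbb N=\{0,\frac12,1,\dots\}$ put $I_{2l+1}=\{-l,-l+1,\dots,l\}$ and let $T^l=(t^l_{ij})_{i,j\in I_{2l+1}}$ be the matrix, in the orthonormal basis $\left[{2l\atop l+j}\right]_{q^{-2}}^{1/2}x^{l-j}y^{l+j}$ ($j\in I_{2l+1}$; Gaussian binomials), of the irreducible corepresentation of $SU_q(2)$ on the homogeneous polynomials of degree $2l$ in the quantum plane $xy=q\,yx$, where $R(x)=x\otimes a+y\otimes c$ and $R(y)=x\otimes b+y\otimes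 d$. Put $[n]_q=\frac{q^n-q^{-n}}{q-q^{-1}}$. The Fourier transform of $f\in L^2(SU_q(2))$ is $\hat f(l)_{mn}=h\big(f(t^l_{nm})^*\big)=\langle t^l_{nm},f\rangle$. A symbol is a function $\sigma$ assigning to each $l\in\frac12\mathbb N$ a $(2l+1)\times(2l+1)$ matrix $\sigma(l)$ with entries in $L^2(SU_q(2))$. Its global pseudo-differential operator is $$T_\sigma f=\sum_{l\in\frac12\mathbb N}[2l+1]_q\,\mathrm{Tr}\big(\sigma(l)\hat f(l)T^l\big)=\sum_{l\in\frac12\mathbb N}[2l+1]_q\sum_{i,j,p\in I_{2l+1}}\hat f(l)_{jp}\,\sigma(l)_{ij}\,t^l_{pi},$$ defined for those $f\in L^2(SU_q(2))$ for which the partial sums (over $l\le L$, $L\to\infty$) converge in norm. For $m\in\frac12\mathbb N$, a symbol $\sigma$ is homogeneous of Fourier order $m$ if for every $l$ there is a map $\psi_\sigma(l)$ from $I_{2l+1}\times I_{2l+1}$ to pairs of half-integers such that $\sigma(l)_{ij}\in\mathrm{Span}\{t^m_{\psi_\sigma(l)(i,j)}\}$ if $\psi_\sigma(l)(i,j)\in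 I_{2m+1}\times I_{2m+1}$, and $\sigma(l)_{ij}=0$ otherwise. For $m\in\frac12\mathbb N$, $m>0$, a symbol $\sigma$ is homogeneous of Fourier order $-m$ if there is a homogeneous symbol $\beta$ of Fourier order $m$ such that $T_\beta T_\sigma f=T_\sigma T_\beta f=f$ (all expressions being defined) for every $f\in\mathcal A$. For $m\in\frac12\mathbb Z$, $\Phi^m(SU_q(2))$ is the set of finite complex linear combinations of homogeneous symbols of Fourier order $m$. **Corollary.** Let $m\in\frac12\mathbb Z$ and let $\sigma\in\Phi^m(SU_q(2))$ be such that, for some $N\in\mathbb N$, $\sigma(l)=0$ for all $l>N$. Then $T_\sigma$ is of finite rank: it is defined on all of $L^2(SU_q(2))$, it is continuous, and its range is finite dimensional. -/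

import Mathlib

open scoped TensorProduct

noncomputable section

/-- The range `0 < q < 1` of the deformation parameter. -/
abbrev QParam : Type := Set.Ioo (0 : ℝ) 1

/-- The real parameter `q`, regarded as a complex scalar. -/
def QParam.toC (q : QParam) : ℂ := ((q : ℝ) : ℂ)

lemma QParam.pos (q : QParam) : 0 < (q : ℝ) := q.2.1

lemma QParam.lt_one (q : QParam) : (q : ℝ) < 1 := q.2.2

lemma QParam.toC_ne_zero (q : QParam) : q.toC ≠ 0 := by
  simpa [QParam.toC] using q.pos.ne'

lemma QParam.star_toC (q : QParam) : star q.toC = q.toC := by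
  simp [QParam.toC]

/-! ### The coordinate `*`-algebra of `SU_q(2)` -/

/-- The defining relations of the coordinate algebra of `SU_q(2)`. -/
structure QSU2Rel {B : Type*} [Ring B] [Algebra ℂ B] (q : QParam) (a b c d : B) : Prop where
  ab : a * b = q.toC • (b * a)
  ac : a * c = q.toC • (c * a)
  bd : b * d = q.toC • (d * b)
  cd : c * d = q.toC • (d * c)
  bc : b * c = c * b
  ad : a * d - q.toC • (b * c) = 1
  da : d * a - q.toC⁻¹ • (b * c) = 1

/-- Names of the four generators. -/
inductive QSU2Gen : Type
  | a | b | c | d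

/-- The defining relations, as a relation on the free algebra on four generators. -/
inductive QSU2FreeRel (q : QParam) :
    FreeAlgebra ℂ QSU2Gen → FreeAlgebra ℂ QSU2Gen → Prop
  | ab : QSU2FreeRel q (.ι ℂ .a * .ι ℂ .b) (q.toC • (.ι ℂ .b * .ι ℂ .a))
  | ac : QSU2FreeRel q (.ι ℂ .a * .ι ℂ .c) (q.toC • (.ι ℂ .c * .ι ℂ .a))
  | bd : QSU2FreeRel q (.ι ℂ .b * .ι ℂ .d) (q.toC • (.ι ℂ .d * .ι ℂ .b))
  | cd : QSU2FreeRel q (.ι ℂ .c * .ι ℂ .d) (q.toC • (.ι ℂ .d * .ι ℂ .c))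
  | bc : QSU2FreeRel q (.ι ℂ .b * .ι ℂ .c) (.ι ℂ .c * .ι ℂ .b)
  | ad : QSU2FreeRel q (.ι ℂ .a * .ι ℂ .d - q.toC • (.ι ℂ .b * .ι ℂ .c)) 1
  | da : QSU2FreeRel q (.ι ℂ .d * .ι ℂ .a - q.toC⁻¹ • (.ι ℂ .b * .ι ℂ .c)) 1

/-- The coordinate algebra of `SU_q(2)`: the unital complex algebra on `a, b, c, d` subject to the
defining relations. -/
def QSU2 (q : QParam) : Type := RingQuot (QSU2FreeRel q)

namespace QSU2

instance (q : QParam) : Ring (QSU2 q) := inferInstanceAs (Ring (RingQuot (QSU2FreeRel q)))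

instance (q : QParam) : Algebra ℂ (QSU2 q) :=
  inferInstanceAs (Algebra ℂ (RingQuot (QSU2FreeRel q)))

/-- The projection from the free algebra. -/
def mk (q : QParam) : FreeAlgebra ℂ QSU2Gen →ₐ[ℂ] QSU2 q := RingQuot.mkAlgHom ℂ (QSU2FreeRel q)

/-- The generators. -/
def gen (q : QParam) (g : QSU2Gen) : QSU2 q := mk q (.ι ℂ g)

lemma mk_surjective (q : QParam) : Function.Surjective (mk q) :=
  RingQuot.mkAlgHom_surjective ℂ _

lemma mk_rel {q : QParam} {x y : FreeAlgebra ℂ QSU2Gen} (h : QSU2FreeRel q x y) :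
    mk q x = mk q y :=
  RingQuot.mkAlgHom_rel ℂ h

lemma gen_rel (q : QParam) : QSU2Rel q (gen q .a) (gen q .b) (gen q .c) (gen q .d) where
  ab := by simpa [gen] using mk_rel (QSU2FreeRel.ab (q := q))
  ac := by simpa [gen] using mk_rel (QSU2FreeRel.ac (q := q))
  bd := by simpa [gen] using mk_rel (QSU2FreeRel.bd (q := q))
  cd := by simpa [gen] using mk_rel (QSU2FreeRel.cd (q := q))
  bc := by simpa [gen] using mk_rel (QSU2FreeRel.bc (q := q))
  ad := by simpa [gen] using mk_rel (QSU2FreeRel.ad (q := q))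
  da := by simpa [gen] using mk_rel (QSU2FreeRel.da (q := q))

/-- Send the generators `a, b, c, d` to four given elements. -/
def genMap {B : Type*} (a b c d : B) : QSU2Gen → B
  | .a => a
  | .b => b
  | .c => c
  | .d => d

/-- The universal property of the coordinate algebra. -/
def lift {q : QParam} {B : Type*} [Ring B] [Algebra ℂ B] {a b c d : B}
    (h : QSU2Rel q a b c d) : QSU2 q →ₐ[ℂ] B :=
  RingQuot.liftAlgHom ℂ ⟨FreeAlgebra.lift ℂ (genMap a b c d), by
    intro x y hxy
    cases hxy <;> simp [genMap, h.ab, h.ac, h.bd, h.cd, h.bc]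
    · exact h.bc ▸ h.ad
    · exact h.bc ▸ h.da⟩

lemma lift_gen {q : QParam} {B : Type*} [Ring B] [Algebra ℂ B] {a b c d : B}
    (h : QSU2Rel q a b c d) (g : QSU2Gen) : lift h (gen q g) = genMap a b c d g :=
  (RingQuot.liftAlgHom_mkAlgHom_apply ℂ _ _ _).trans (FreeAlgebra.lift_ι_apply _ _)

@[elab_as_elim]
lemma induction {q : QParam} {P : QSU2 q → Prop} (scalar : ∀ z : ℂ, P (algebraMap ℂ _ z))
    (gens : ∀ g, P (gen q g)) (mul : ∀ x y, P x → P y → P (x * y))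
    (add : ∀ x y, P x → P y → P (x + y)) (x : QSU2 q) : P x := by
  obtain ⟨x, rfl⟩ := mk_surjective q x
  induction x with
  | grade0 z => simpa using scalar z
  | grade1 g => exact gens g
  | mul x y hx hy => simpa using mul _ _ hx hy
  | add x y hx hy => simpa using add _ _ hx hy

end QSU2

/-- The opposite algebra with complex conjugate scalars; algebra homomorphisms into it are
conjugate-linear antihomomorphisms. -/
def ConjOp (B : Type*) : Type _ := Bᵐᵒᵖ

namespace ConjOp

instance (B : Type*) [Ring B] : Ring (ConjOp B) := inferInstanceAs (Ring Bᵐᵒᵖ)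

instance (B : Type*) [Ring B] [Algebra ℂ B] : Algebra ℂ (ConjOp B) :=
  RingHom.toAlgebra' ((algebraMap ℂ Bᵐᵒᵖ).comp (starRingEnd ℂ)) fun z x =>
    Algebra.commutes (A := Bᵐᵒᵖ) (starRingEnd ℂ z) x

def op {B : Type*} (x : B) : ConjOp B := MulOpposite.op x

def unop {B : Type*} (x : ConjOp B) : B := MulOpposite.unop x

@[simp] lemma unop_op {B : Type*} (x : B) : (op x).unop = x := rfl

lemma op_mul {B : Type*} [Ring B] (x y : B) : op x * op y = op (y * x) := rfl

lemma op_sub {B : Type*} [Ring B] (x y : B) : op x - op y = op (x - y) := rfl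

lemma op_one {B : Type*} [Ring B] : op (1 : B) = 1 := rfl

lemma unop_mul {B : Type*} [Ring B] (x y : ConjOp B) : (x * y).unop = y.unop * x.unop := rfl

lemma unop_add {B : Type*} [Ring B] (x y : ConjOp B) : (x + y).unop = x.unop + y.unop := rfl

lemma unop_algebraMap {B : Type*} [Ring B] [Algebra ℂ B] (z : ℂ) :
    (algebraMap ℂ (ConjOp B) z).unop = algebraMap ℂ B (star z) := rfl

lemma smul_op {B : Type*} [Ring B] [Algebra ℂ B] (z : ℂ) (x : B) : z • op x = op (star z • x) := by
  rw [Algebra.smul_def]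
  change MulOpposite.op (x * algebraMap ℂ B (star z)) = MulOpposite.op (star z • x)
  rw [Algebra.smul_def, Algebra.commutes]

end ConjOp

namespace QSU2

open ConjOp in
lemma star_rel (q : QParam) : QSU2Rel q (op (gen q .d)) (op (-q.toC • gen q .c))
    (op (-q.toC⁻¹ • gen q .b)) (op (gen q .a)) := by
  have h := gen_rel q
  have hq := q.toC_ne_zero
  have hs : star q.toC⁻¹ = q.toC⁻¹ := by rw [star_inv₀, q.star_toC]
  constructor <;> simp only [op_mul, smul_op, op_sub, q.star_toC, hs, ← op_one] <;>
    congr 1 <;> simp [h.ab, h.ac, h.bd, h.cd, smul_smul, hq]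
  · rw [h.bc]
  · exact h.bc ▸ h.ad
  · exact h.bc ▸ h.da

/-- The involution as an algebra homomorphism into the conjugate opposite algebra. It is determined
by `a* = d`, `b* = -q c`, `c* = -q⁻¹ b`, `d* = a`. -/
def starHom (q : QParam) : QSU2 q →ₐ[ℂ] ConjOp (QSU2 q) := lift (star_rel q)

instance (q : QParam) : Star (QSU2 q) := ⟨fun x => (starHom q x).unop⟩

lemma star_def {q : QParam} (x : QSU2 q) : star x = (starHom q x).unop := rfl

lemma star_mul' {q : QParam} (x y : QSU2 q) : star (x * y) = star y * star x := by
  simp [star_def, ConjOp.unop_mul]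

lemma star_add' {q : QParam} (x y : QSU2 q) : star (x + y) = star x + star y := by
  simp [star_def, ConjOp.unop_add]

lemma star_algebraMap' {q : QParam} (z : ℂ) :
    star (algebraMap ℂ (QSU2 q) z) = algebraMap ℂ _ (star z) := by
  rw [star_def, AlgHom.commutes, ConjOp.unop_algebraMap]

lemma star_smul' {q : QParam} (z : ℂ) (x : QSU2 q) : star (z • x) = star z • star x := by
  rw [Algebra.smul_def, star_mul', star_algebraMap', ← Algebra.commutes, Algebra.smul_def]

lemma star_a (q : QParam) : star (gen q .a) = gen q .d := by
  simp [star_def, starHom, lift_gen, genMap]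

lemma star_b (q : QParam) : star (gen q .b) = -q.toC • gen q .c := by
  simp [star_def, starHom, lift_gen, genMap]

lemma star_c (q : QParam) : star (gen q .c) = -q.toC⁻¹ • gen q .b := by
  simp [star_def, starHom, lift_gen, genMap]

lemma star_d (q : QParam) : star (gen q .d) = gen q .a := by
  simp [star_def, starHom, lift_gen, genMap]

instance (q : QParam) : StarRing (QSU2 q) where
  star_involutive x := by
    have hq := q.toC_ne_zero
    induction x using QSU2.induction with
    | scalar z => simp [star_algebraMap']
    | gens g =>
      have hs : star (-q.toC) = -q.toC := by rw [star_neg, q.star_toC]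
      have hs' : star (-q.toC⁻¹) = -q.toC⁻¹ := by rw [star_neg, star_inv₀, q.star_toC]
      cases g <;> simp only [star_a, star_b, star_c, star_d, star_smul', hs, hs', smul_smul] <;>
        simp [hq]
    | mul x y hx hy => simp [star_mul', hx, hy]
    | add x y hx hy => simp [star_add', hx, hy]
  star_mul := star_mul'
  star_add := star_add'

instance (q : QParam) : StarModule ℂ (QSU2 q) := ⟨star_smul'⟩

end QSU2

/-! ### Woronowicz's representation and the Haar state -/

/-- For a weight `w` bounded by one and a map `φ` that is injective where `w` does not vanish,
`f ↦ w • (f ∘ φ)` is a contraction of `ℓ²(X)`. -/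
lemma summable_weighted {X : Type*} {w : X → ℂ} {φ : X → X} (hw : ∀ x, ‖w x‖ ≤ 1)
    (hφ : Set.InjOn φ {x | w x ≠ 0}) (f : lp (fun _ : X => ℂ) 2) (s : Finset X) :
    ∑ x ∈ s, ‖w x * f (φ x)‖ ^ (2 : ENNReal).toReal ≤ ‖f‖ ^ (2 : ENNReal).toReal := by
  classical
  have h2 : 0 < (2 : ENNReal).toReal := by norm_num
  calc ∑ x ∈ s, ‖w x * f (φ x)‖ ^ (2 : ENNReal).toReal
      = ∑ x ∈ s with w x ≠ 0, ‖w x * f (φ x)‖ ^ (2 : ENNReal).toReal := by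
        refine (Finset.sum_filter_of_ne (p := fun x => w x ≠ 0) fun x _ hx h0 => hx ?_).symm
        simp [h0]
    _ ≤ ∑ x ∈ s with w x ≠ 0, ‖f (φ x)‖ ^ (2 : ENNReal).toReal := by
        refine Finset.sum_le_sum fun x _ => Real.rpow_le_rpow (norm_nonneg _) ?_ h2.le
        rw [norm_mul]
        exact mul_le_of_le_one_left (norm_nonneg _) (hw x)
    _ = ∑ y ∈ (s.filter (w · ≠ 0)).image φ, ‖f y‖ ^ (2 : ENNReal).toReal := by
        rw [Finset.sum_image]
        intro x hx y hy h
        exact hφ (by simpa using (Finset.mem_filter.1 hx).2)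
          (by simpa using (Finset.mem_filter.1 hy).2) h
    _ ≤ ‖f‖ ^ (2 : ENNReal).toReal := lp.sum_rpow_le_norm_rpow h2 f _

/-- The operator `(W f)(x) = w(x) f(φ(x))` on `ℓ²(X)`. -/
def weightedComp {X : Type*} (w : X → ℂ) (φ : X → X) (hw : ∀ x, ‖w x‖ ≤ 1)
    (hφ : Set.InjOn φ {x | w x ≠ 0}) : lp (fun _ : X => ℂ) 2 →L[ℂ] lp (fun _ : X => ℂ) 2 :=
  LinearMap.mkContinuous
    { toFun := fun f => ⟨fun x => w x * f (φ x), memℓp_gen' (summable_weighted hw hφ f)⟩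
      map_add' := fun f g => by ext x; exact mul_add (w x) (f (φ x)) (g (φ x))
      map_smul' := fun z f => by ext x; exact mul_left_comm (w x) z (f (φ x)) } 1 fun f => by
    rw [one_mul]
    exact lp.norm_le_of_forall_sum_le (by norm_num) (norm_nonneg f) (summable_weighted hw hφ f)

lemma weightedComp_apply {X : Type*} (w : X → ℂ) (φ : X → X) (hw : ∀ x, ‖w x‖ ≤ 1)
    (hφ : Set.InjOn φ {x | w x ≠ 0}) (f : lp (fun _ : X => ℂ) 2) (x : X) :
    weightedComp w φ hw hφ f x = w x * f (φ x) := rfl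

namespace QSU2

/-- The Hilbert space `ℓ²(ℤ × ℕ)`. -/
abbrev L2 : Type := lp (fun _ : ℤ × ℕ => ℂ) 2

/-- The standard orthonormal basis `e k n` of `ℓ²(ℤ × ℕ)`. -/
def e (k : ℤ) (n : ℕ) : L2 := lp.single 2 (k, n) (1 : ℂ)

/-- The number `√(1 - q^{2n})`. -/
def wt (q : QParam) (n : ℕ) : ℝ := √(1 - (q : ℝ) ^ (2 * n))

lemma wt_sq (q : QParam) (n : ℕ) : (wt q n : ℂ) * wt q n = 1 - q.toC ^ (2 * n) := by
  have h : (q : ℝ) ^ (2 * n) ≤ 1 := pow_le_one₀ q.pos.le q.lt_one.le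
  have := Real.mul_self_sqrt (sub_nonneg.2 h)
  rw [wt, ← Complex.ofReal_mul, this]
  simp [QParam.toC]

lemma norm_wt_le (q : QParam) (n : ℕ) : ‖(wt q n : ℂ)‖ ≤ 1 := by
  rw [Complex.norm_real, wt, Real.norm_of_nonneg (Real.sqrt_nonneg _),
    Real.sqrt_le_left zero_le_one]
  have : 0 ≤ (q : ℝ) ^ (2 * n) := pow_nonneg q.pos.le _
  linarith

lemma wt_zero (q : QParam) : wt q 0 = 0 := by simp [wt]

lemma norm_pow_le (q : QParam) (n : ℕ) : ‖q.toC ^ n‖ ≤ 1 := by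
  rw [norm_pow, QParam.toC, Complex.norm_real, Real.norm_of_nonneg q.pos.le]
  exact pow_le_one₀ q.pos.le q.lt_one.le

/-- The operator `a e_{k,n} = √(1 - q^{2n}) e_{k,n-1}`, where `a e_{k,0} = 0`. -/
def opA (q : QParam) : L2 →L[ℂ] L2 :=
  weightedComp (fun x => wt q (x.2 + 1)) (fun x => (x.1, x.2 + 1)) (fun _ => norm_wt_le q _)
    (by rintro ⟨k, n⟩ - ⟨l, m⟩ - h; simpa using h)

/-- The adjoint `a* e_{k,n} = √(1 - q^{2n+2}) e_{k,n+1}`. -/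
def opAStar (q : QParam) : L2 →L[ℂ] L2 :=
  weightedComp (fun x => wt q x.2) (fun x => (x.1, x.2 - 1)) (fun _ => norm_wt_le q _) (by
    rintro ⟨k, n⟩ hn ⟨l, m⟩ hm h
    have hn' : n ≠ 0 := fun h => hn (by simp [h, wt_zero])
    have hm' : m ≠ 0 := fun h => hm (by simp [h, wt_zero])
    simp only [Prod.mk.injEq] at h ⊢
    omega)

/-- The operator `c e_{k,n} = q^n e_{k+1,n}`. -/
def opC (q : QParam) : L2 →L[ℂ] L2 :=
  weightedComp (fun x => q.toC ^ x.2) (fun x => (x.1 - 1, x.2)) (fun _ => norm_pow_le q _)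
    (by rintro ⟨k, n⟩ - ⟨l, m⟩ - h; simpa using h)

/-- The adjoint `c* e_{k,n} = q^n e_{k-1,n}`. -/
def opCStar (q : QParam) : L2 →L[ℂ] L2 :=
  weightedComp (fun x => q.toC ^ x.2) (fun x => (x.1 + 1, x.2)) (fun _ => norm_pow_le q _)
    (by rintro ⟨k, n⟩ - ⟨l, m⟩ - h; simpa using h)

lemma e_apply (k l : ℤ) (n m : ℕ) : e k n (l, m) = if l = k ∧ m = n then (1 : ℂ) else 0 := by
  simp [e, Pi.single_apply]

lemma opA_apply (q : QParam) (f : L2) (k : ℤ) (n : ℕ) :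
    opA q f (k, n) = wt q (n + 1) * f (k, n + 1) := rfl

lemma opAStar_apply (q : QParam) (f : L2) (k : ℤ) (n : ℕ) :
    opAStar q f (k, n) = wt q n * f (k, n - 1) := rfl

lemma opC_apply (q : QParam) (f : L2) (k : ℤ) (n : ℕ) :
    opC q f (k, n) = q.toC ^ n * f (k - 1, n) := rfl

lemma opCStar_apply (q : QParam) (f : L2) (k : ℤ) (n : ℕ) :
    opCStar q f (k, n) = q.toC ^ n * f (k + 1, n) := rfl

lemma opA_e_zero (q : QParam) (k : ℤ) : opA q (e k 0) = 0 := by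
  ext ⟨l, m⟩
  simp [opA_apply, e_apply]

lemma opA_e_succ (q : QParam) (k : ℤ) (n : ℕ) :
    opA q (e k (n + 1)) = (wt q (n + 1) : ℂ) • e k n := by
  ext ⟨l, m⟩
  rw [opA_apply, lp.coeFn_smul, Pi.smul_apply, e_apply, e_apply]
  by_cases h : l = k ∧ m = n
  · simp [h]
  · simp [h]

lemma opC_e (q : QParam) (k : ℤ) (n : ℕ) : opC q (e k n) = q.toC ^ n • e (k + 1) n := by
  ext ⟨l, m⟩
  rw [opC_apply, lp.coeFn_smul, Pi.smul_apply, e_apply, e_apply]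
  simp only [sub_eq_iff_eq_add]
  by_cases h : l = k + 1 ∧ m = n
  · simp [h]
  · simp [h]

lemma apply_eq_inner (f : L2) (k : ℤ) (n : ℕ) : f (k, n) = inner ℂ (e k n) f := by
  simp [e, lp.inner_single_left]

open ContinuousLinearMap in
lemma adjoint_opA (q : QParam) : adjoint (opA q) = opAStar q := by
  ext f ⟨k, n⟩
  rw [apply_eq_inner, adjoint_inner_right, opAStar_apply]
  cases n with
  | zero => simp [opA_e_zero, wt_zero]
  | succ n => rw [opA_e_succ, inner_smul_left, apply_eq_inner]; simp

open ContinuousLinearMap in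
lemma adjoint_opC (q : QParam) : adjoint (opC q) = opCStar q := by
  ext f ⟨k, n⟩
  have h : star (q.toC ^ n) = q.toC ^ n := by rw [star_pow, q.star_toC]
  rw [apply_eq_inner, adjoint_inner_right, opCStar_apply, opC_e, inner_smul_left, apply_eq_inner]
  exact congrArg (· * _) h

lemma op_rel (q : QParam) :
    QSU2Rel q (opA q) (-q.toC • opCStar q) (opC q) (opAStar q) := by
  have hq := q.toC_ne_zero
  constructor <;> ext f ⟨k, n⟩
  · change wt q (n + 1) * (-q.toC * (q.toC ^ (n + 1) * f (k + 1, n + 1)))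
      = q.toC * (-q.toC * (q.toC ^ n * (wt q (n + 1) * f (k + 1, n + 1))))
    ring
  · change wt q (n + 1) * (q.toC ^ (n + 1) * f (k - 1, n + 1))
      = q.toC * (q.toC ^ n * (wt q (n + 1) * f (k - 1, n + 1)))
    ring
  · change -q.toC * (q.toC ^ n * (wt q n * f (k + 1, n - 1)))
      = q.toC * (wt q n * (-q.toC * (q.toC ^ (n - 1) * f (k + 1, n - 1))))
    cases n with
    | zero => simp [wt_zero]
    | succ n => rw [Nat.add_sub_cancel]; ring
  · change q.toC ^ n * (wt q n * f (k - 1, n - 1))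
      = q.toC * (wt q n * (q.toC ^ (n - 1) * f (k - 1, n - 1)))
    cases n with
    | zero => simp [wt_zero]
    | succ n => rw [Nat.add_sub_cancel]; ring
  · change -q.toC * (q.toC ^ n * (q.toC ^ n * f (k + 1 - 1, n)))
      = q.toC ^ n * (-q.toC * (q.toC ^ n * f (k - 1 + 1, n)))
    rw [add_sub_cancel_right, sub_add_cancel]; ring
  · change wt q (n + 1) * (wt q (n + 1) * f (k, n + 1 - 1))
      - q.toC * (-q.toC * (q.toC ^ n * (q.toC ^ n * f (k + 1 - 1, n)))) = f (k, n)
    rw [add_sub_cancel_right, Nat.add_sub_cancel, ← mul_assoc, wt_sq]; ring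
  · change wt q n * (wt q (n - 1 + 1) * f (k, n - 1 + 1))
      - q.toC⁻¹ * (-q.toC * (q.toC ^ n * (q.toC ^ n * f (k + 1 - 1, n)))) = f (k, n)
    have h : wt q n * (wt q (n - 1 + 1) * f (k, n - 1 + 1)) = (1 - q.toC ^ (2 * n)) * f (k, n) := by
      cases n with
      | zero => simp [wt_zero]
      | succ n => rw [Nat.add_sub_cancel, ← mul_assoc, wt_sq]
    rw [h, add_sub_cancel_right]
    field_simp
    ring

/-- The `*`-representation of the coordinate algebra on `ℓ²(ℤ × ℕ)` with
`a e_{k,n} = √(1 - q^{2n}) e_{k,n-1}` and `c e_{k,n} = q^n e_{k+1,n}`. -/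
def rep (q : QParam) : QSU2 q →ₐ[ℂ] (L2 →L[ℂ] L2) := lift (op_rel q)

open ContinuousLinearMap in
lemma rep_star (q : QParam) (x : QSU2 q) : rep q (star x) = adjoint (rep q x) := by
  have hq := q.toC_ne_zero
  have ha : rep q (gen q .a) = opA q := lift_gen _ _
  have hb : rep q (gen q .b) = -q.toC • opCStar q := lift_gen _ _
  have hc : rep q (gen q .c) = opC q := lift_gen _ _
  have hd : rep q (gen q .d) = opAStar q := lift_gen _ _
  have hs : starRingEnd ℂ (-q.toC) = -q.toC := by
    rw [map_neg]; exact congrArg _ q.star_toC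
  induction x using QSU2.induction with
  | scalar z =>
    rw [star_algebraMap', AlgHom.commutes, AlgHom.commutes, ← star_eq_adjoint, ← algebraMap_star_comm]
  | gens g =>
    cases g
    · rw [star_a, ha, hd, adjoint_opA]
    · rw [star_b, map_smul, hb, hc, map_smulₛₗ, hs, ← adjoint_opC, adjoint_adjoint]
    · rw [star_c, map_smul, hb, hc, adjoint_opC, smul_smul]; simp [hq]
    · rw [star_d, ha, hd, ← adjoint_opA, adjoint_adjoint]
  | mul x y hx hy =>
    rw [star_mul', map_mul, map_mul, hx, hy, ← star_eq_adjoint, ← star_eq_adjoint,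
      ← star_eq_adjoint, star_mul]
  | add x y hx hy => rw [star_add', map_add, map_add, hx, hy, map_add]

end QSU2

namespace QSU2

open ContinuousLinearMap

/-- The diagonal matrix coefficient `⟨e_{0,n}, π(f) e_{0,n}⟩`. -/
def diagCoeff (q : QParam) (n : ℕ) (f : QSU2 q) : ℂ := inner ℂ (e 0 n) (rep q f (e 0 n))

lemma norm_e (k : ℤ) (n : ℕ) : ‖e k n‖ = 1 := by
  simp [e, lp.norm_single]

lemma q_sq_lt_one (q : QParam) : (q : ℝ) ^ 2 < 1 :=
  pow_lt_one₀ q.pos.le q.lt_one two_ne_zero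

lemma summable_q (q : QParam) (C : ℝ) : Summable fun n : ℕ => (q : ℝ) ^ (2 * n) * C := by
  simp only [pow_mul]
  exact (summable_geometric_of_lt_one (sq_nonneg _) (q_sq_lt_one q)).mul_right C

lemma summable_diagCoeff (q : QParam) (f : QSU2 q) :
    Summable fun n : ℕ => q.toC ^ (2 * n) * diagCoeff q n f := by
  refine Summable.of_norm_bounded (summable_q q ‖rep q f‖) fun n => ?_
  rw [norm_mul, norm_pow, QParam.toC, Complex.norm_real, Real.norm_of_nonneg q.pos.le]
  refine mul_le_mul_of_nonneg_left ?_ (pow_nonneg q.pos.le _)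
  refine (norm_inner_le_norm _ _).trans ?_
  rw [norm_e, one_mul]
  simpa [norm_e] using (rep q f).le_opNorm (e 0 n)

/-- The Haar state of `SU_q(2)`, given by Woronowicz's formula
`h(f) = (1 - q²) ∑_{n ≥ 0} q^{2n} ⟨e_{0,n}, π(f) e_{0,n}⟩`. -/
def haar (q : QParam) : QSU2 q →ₗ[ℂ] ℂ where
  toFun f := (1 - q.toC ^ 2) * ∑' n : ℕ, q.toC ^ (2 * n) * diagCoeff q n f
  map_add' f g := by
    rw [← mul_add, ← (summable_diagCoeff q f).tsum_add (summable_diagCoeff q g)]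
    simp [diagCoeff, mul_add]
  map_smul' z f := by
    have h : ∀ n, q.toC ^ (2 * n) * diagCoeff q n (z • f) =
        z * (q.toC ^ (2 * n) * diagCoeff q n f) := fun n => by
      simp [diagCoeff, mul_left_comm]
    rw [RingHom.id_apply, smul_eq_mul, tsum_congr h, tsum_mul_left, mul_left_comm]

lemma haar_apply (q : QParam) (f : QSU2 q) :
    haar q f = (1 - q.toC ^ 2) * ∑' n : ℕ, q.toC ^ (2 * n) * diagCoeff q n f := rfl

lemma haar_one (q : QParam) : haar q 1 = 1 := by
  have h : ∀ n, diagCoeff q n (1 : QSU2 q) = 1 := fun n => by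
    simp [diagCoeff, norm_e]
  have h2 : ‖q.toC ^ 2‖ < 1 := by
    rw [norm_pow, QParam.toC, Complex.norm_real, Real.norm_of_nonneg q.pos.le]
    exact q_sq_lt_one q
  have h3 : 1 - q.toC ^ 2 ≠ 0 := by
    intro h0
    rw [← sub_eq_zero.1 h0] at h2
    simp at h2
  simp only [haar_apply, h, mul_one, pow_mul]
  rw [tsum_geometric_of_norm_lt_one h2, mul_inv_cancel₀ h3]

lemma haar_star (q : QParam) (f : QSU2 q) : haar q (star f) = star (haar q f) := by
  have h : ∀ n, diagCoeff q n (star f) = star (diagCoeff q n f) := fun n => by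
    rw [diagCoeff, rep_star, adjoint_inner_right, diagCoeff]
    exact (inner_conj_symm _ _).symm
  rw [haar_apply, haar_apply, StarMul.star_mul, tsum_star, star_sub, star_pow, q.star_toC,
    star_one, mul_comm]
  simp only [h, StarMul.star_mul, star_pow, q.star_toC, mul_comm]

/-- `h(f f*) = (1 - q²) ∑ q^{2n} ‖π(f)* e_{0,n}‖²`. -/
lemma haar_mul_star (q : QParam) (f : QSU2 q) :
    haar q (f * star f) = (((1 - (q : ℝ) ^ 2) *
      ∑' n : ℕ, (q : ℝ) ^ (2 * n) * ‖adjoint (rep q f) (e 0 n)‖ ^ 2 : ℝ) : ℂ) := by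
  have h : ∀ n, diagCoeff q n (f * star f) = ((‖adjoint (rep q f) (e 0 n)‖ ^ 2 : ℝ) : ℂ) := by
    intro n
    rw [diagCoeff, map_mul, rep_star, mul_apply_eq_comp, ← adjoint_inner_left]
    simp [inner_self_eq_norm_sq_to_K]
  simp only [haar_apply, h]
  push_cast
  rfl

/-- The positive semidefinite inner product `⟨y, x⟩ = h(x y*)`. -/
@[reducible] def preInner (q : QParam) : PreInnerProductSpace.Core ℂ (QSU2 q) where
  inner y x := haar q (x * star y)
  conj_inner_symm x y := by
    change star (haar q (x * star y)) = haar q (y * star x)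
    rw [← haar_star, StarMul.star_mul, star_star]
  re_inner_nonneg x := by
    rw [haar_mul_star]
    simp only [RCLike.re_to_complex, Complex.ofReal_re]
    exact mul_nonneg (sub_nonneg.2 (q_sq_lt_one q).le)
      (tsum_nonneg fun n => mul_nonneg (pow_nonneg q.pos.le _) (sq_nonneg _))
  add_left x y z := by
    change haar q (z * star (x + y)) = haar q (z * star x) + haar q (z * star y)
    rw [star_add, mul_add, map_add]
  smul_left x y z := by
    change haar q (y * star (z • x)) = star z * haar q (y * star x)
    rw [star_smul, mul_smul_comm, map_smul, smul_eq_mul]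

instance (q : QParam) : SeminormedAddCommGroup (QSU2 q) :=
  @InnerProductSpace.Core.toSeminormedAddCommGroup ℂ (QSU2 q) _ _ _ (preInner q)

instance (q : QParam) : InnerProductSpace ℂ (QSU2 q) := InnerProductSpace.ofCore (preInner q)

lemma inner_eq (q : QParam) (x y : QSU2 q) : inner ℂ y x = haar q (x * star y) := rfl

lemma norm_sq_eq (q : QParam) (f : QSU2 q) : ((‖f‖ ^ 2 : ℝ) : ℂ) = haar q (f * star f) := by
  rw [← inner_eq, inner_self_eq_norm_sq_to_K]
  simp

lemma norm_mul_le' (q : QParam) (f t : QSU2 q) : ‖f * t‖ ≤ ‖rep q t‖ * ‖f‖ := by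
  have key : ∀ g : QSU2 q, ‖g‖ ^ 2 = (1 - (q : ℝ) ^ 2) *
      ∑' n : ℕ, (q : ℝ) ^ (2 * n) * ‖adjoint (rep q g) (e 0 n)‖ ^ 2 := fun g =>
    Complex.ofReal_injective ((norm_sq_eq q g).trans (haar_mul_star q g))
  have hs : ∀ g : QSU2 q, Summable fun n : ℕ =>
      (q : ℝ) ^ (2 * n) * ‖adjoint (rep q g) (e 0 n)‖ ^ 2 := fun g => by
    refine Summable.of_nonneg_of_le (fun n => mul_nonneg (pow_nonneg q.pos.le _) (sq_nonneg _))
      (fun n => ?_) (summable_q q (‖adjoint (rep q g)‖ ^ 2))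
    have := (adjoint (rep q g)).le_opNorm (e 0 n)
    rw [norm_e, mul_one] at this
    have h0 := pow_nonneg q.pos.le (2 * n)
    gcongr
  refine abs_le_of_sq_le_sq' ?_ (by positivity) |>.2
  rw [mul_pow, key, key, mul_left_comm, ← tsum_mul_left (a := ‖rep q t‖ ^ 2)]
  refine mul_le_mul_of_nonneg_left ?_ (sub_nonneg.2 (q_sq_lt_one q).le)
  refine (hs _).tsum_le_tsum (fun n => ?_) ((hs f).mul_left _)
  rw [mul_left_comm, ← mul_pow]
  have h0 := pow_nonneg q.pos.le (2 * n)
  have h1 : adjoint (rep q (f * t)) (e 0 n) = adjoint (rep q t) (adjoint (rep q f) (e 0 n)) := by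
    rw [← rep_star, ← rep_star, ← rep_star, StarMul.star_mul, map_mul]
    rfl
  have h2 := (adjoint (rep q t)).le_opNorm (adjoint (rep q f) (e 0 n))
  rw [LinearIsometryEquiv.norm_map] at h2
  rw [h1]
  gcongr

/-- The Hilbert space `L²(SU_q(2))`: the completion of the coordinate algebra for the norm
`‖f‖² = h(f f*)`. -/
abbrev Hilb (q : QParam) : Type := UniformSpace.Completion (QSU2 q)

/-- Right multiplication by `t` on the coordinate algebra, as a continuous linear map. -/
def rmul₀ {q : QParam} (t : QSU2 q) : QSU2 q →L[ℂ] QSU2 q :=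
  LinearMap.mkContinuous (LinearMap.mulRight ℂ t) ‖rep q t‖ fun f => norm_mul_le' q f t

/-- Right multiplication by an element `t` of the coordinate algebra, extended by continuity to
`L²(SU_q(2))`. -/
def rmul {q : QParam} (t : QSU2 q) : Hilb q →L[ℂ] Hilb q :=
  ((UniformSpace.Completion.toComplL (𝕜 := ℂ) (E := QSU2 q)).comp (rmul₀ t)).extend
    (UniformSpace.Completion.toComplL (𝕜 := ℂ) (E := QSU2 q))

lemma rmul_coe {q : QParam} (f t : QSU2 q) : rmul t (f : Hilb q) = ((f * t : QSU2 q) : Hilb q) := by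
  rw [rmul]
  exact extend_eq _ (UniformSpace.Completion.denseRange_coe)
    (UniformSpace.Completion.isUniformInducing_coe _) f

end QSU2

/-! ### The quantum plane and the matrix corepresentations -/

/-- The relation `x y = q y x`; the generators are `x = ι 0` and `y = ι 1`. -/
inductive QPlaneRel (q : QParam) : FreeAlgebra ℂ (Fin 2) → FreeAlgebra ℂ (Fin 2) → Prop
  | xy : QPlaneRel q (.ι ℂ 0 * .ι ℂ 1) (q.toC • (.ι ℂ 1 * .ι ℂ 0))

/-- The quantum plane: the complex algebra generated by `x, y` with the relation `x y = q y x`. -/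
def QPlane (q : QParam) : Type := RingQuot (QPlaneRel q)

namespace QPlane

instance (q : QParam) : Ring (QPlane q) := inferInstanceAs (Ring (RingQuot (QPlaneRel q)))

instance (q : QParam) : Algebra ℂ (QPlane q) :=
  inferInstanceAs (Algebra ℂ (RingQuot (QPlaneRel q)))

/-- The projection from the free algebra. -/
def mk (q : QParam) : FreeAlgebra ℂ (Fin 2) →ₐ[ℂ] QPlane q := RingQuot.mkAlgHom ℂ (QPlaneRel q)

/-- The coordinate `x`. -/
def x (q : QParam) : QPlane q := mk q (.ι ℂ 0)

/-- The coordinate `y`. -/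
def y (q : QParam) : QPlane q := mk q (.ι ℂ 1)

lemma x_mul_y (q : QParam) : x q * y q = q.toC • (y q * x q) := by
  have h : mk q (.ι ℂ 0 * .ι ℂ 1) = mk q (q.toC • (.ι ℂ 1 * .ι ℂ 0)) :=
    RingQuot.mkAlgHom_rel ℂ .xy
  simpa [x, y] using h

/-- The universal property of the quantum plane. -/
def lift {q : QParam} {B : Type*} [Ring B] [Algebra ℂ B] (u v : B)
    (h : u * v = q.toC • (v * u)) : QPlane q →ₐ[ℂ] B :=
  RingQuot.liftAlgHom ℂ ⟨FreeAlgebra.lift ℂ ![u, v], by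
    intro x y hxy
    cases hxy
    simp [h]⟩

lemma lift_x {q : QParam} {B : Type*} [Ring B] [Algebra ℂ B] (u v : B)
    (h : u * v = q.toC • (v * u)) : lift u v h (x q) = u :=
  (RingQuot.liftAlgHom_mkAlgHom_apply ℂ _ _ _).trans (FreeAlgebra.lift_ι_apply _ _)

lemma lift_y {q : QParam} {B : Type*} [Ring B] [Algebra ℂ B] (u v : B)
    (h : u * v = q.toC • (v * u)) : lift u v h (y q) = v :=
  (RingQuot.liftAlgHom_mkAlgHom_apply ℂ _ _ _).trans (FreeAlgebra.lift_ι_apply _ _)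

/-- The ordered monomials `x^i y^j`. -/
def monomial (q : QParam) (p : ℕ × ℕ) : QPlane q := x q ^ p.1 * y q ^ p.2

/-- The operator `e_{i,j} ↦ e_{i+1,j}`. -/
def modelX : Module.End ℂ (ℕ × ℕ →₀ ℂ) := Finsupp.lmapDomain ℂ ℂ fun p => (p.1 + 1, p.2)

/-- The operator `e_{i,j} ↦ q^{-i} e_{i,j+1}`. -/
def modelY (q : QParam) : Module.End ℂ (ℕ × ℕ →₀ ℂ) :=
  Finsupp.lsum ℂ fun p => (q.toC⁻¹ ^ p.1) • Finsupp.lsingle (p.1, p.2 + 1)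

lemma modelX_single (i j : ℕ) (z : ℂ) :
    modelX (Finsupp.single (i, j) z) = Finsupp.single (i + 1, j) z := by
  simp [modelX]

lemma modelY_single (q : QParam) (i j : ℕ) (z : ℂ) :
    modelY q (Finsupp.single (i, j) z) = Finsupp.single (i, j + 1) (q.toC⁻¹ ^ i * z) := by
  simp [modelY]

lemma model_rel (q : QParam) : modelX * modelY q = q.toC • (modelY q * modelX) := by
  have hq := q.toC_ne_zero
  refine Finsupp.lhom_ext fun p z => ?_
  obtain ⟨i, j⟩ := p
  simp only [Module.End.mul_apply, LinearMap.smul_apply, modelX_single, modelY_single,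
    Finsupp.smul_single, smul_eq_mul]
  congr 1
  rw [pow_succ]
  field_simp

/-- Left multiplication on the quantum plane in the monomial basis. -/
def model (q : QParam) : QPlane q →ₐ[ℂ] Module.End ℂ (ℕ × ℕ →₀ ℂ) :=
  lift modelX (modelY q) (model_rel q)

lemma model_monomial (q : QParam) (p : ℕ × ℕ) :
    model q (monomial q p) (Finsupp.single (0, 0) 1) = Finsupp.single p 1 := by
  obtain ⟨i, j⟩ := p
  have hy : ∀ j : ℕ, (modelY q ^ j) (Finsupp.single (0, 0) 1) = Finsupp.single (0, j) 1 := by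
    intro j
    induction j with
    | zero => simp
    | succ j ih => rw [pow_succ', Module.End.mul_apply, ih, modelY_single]; simp
  have hx : ∀ i : ℕ, (modelX ^ i) (Finsupp.single (0, j) (1 : ℂ)) = Finsupp.single (i, j) 1 := by
    intro i
    induction i with
    | zero => simp
    | succ i ih => rw [pow_succ', Module.End.mul_apply, ih, modelX_single]
  simp [monomial, model, lift_x, lift_y, hy, hx]

lemma linearIndependent_monomial (q : QParam) : LinearIndependent ℂ (monomial q) := by
  refine LinearIndependent.of_comp
    ((LinearMap.applyₗ (Finsupp.single (0, 0) (1 : ℂ))).comp (model q).toLinearMap) ?_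
  have : (((LinearMap.applyₗ (Finsupp.single (0, 0) (1 : ℂ))).comp (model q).toLinearMap) ∘
      monomial q) = fun p => Finsupp.single p (1 : ℂ) := funext fun p => model_monomial q p
  rw [this]
  simpa using (Finsupp.basisSingleOne (R := ℂ) (ι := ℕ × ℕ)).linearIndependent

lemma y_mul_pow (q : QParam) (i : ℕ) : y q * x q ^ i = q.toC⁻¹ ^ i • (x q ^ i * y q) := by
  have h : y q * x q = q.toC⁻¹ • (x q * y q) := by
    rw [x_mul_y, smul_smul, inv_mul_cancel₀ q.toC_ne_zero, one_smul]
  induction i with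
  | zero => simp
  | succ i ih =>
    rw [pow_succ, ← mul_assoc, ih, smul_mul_assoc, mul_assoc, h, mul_smul_comm, smul_smul,
      ← mul_assoc, pow_succ]

lemma span_monomial (q : QParam) : ⊤ ≤ Submodule.span ℂ (Set.range (monomial q)) := by
  set S := Submodule.span ℂ (Set.range (monomial q)) with hS
  have hx : ∀ s ∈ S, x q * s ∈ S := by
    intro s hs
    have : S ≤ S.comap (LinearMap.mulLeft ℂ (x q)) := by
      rw [hS, Submodule.span_le]
      rintro _ ⟨⟨i, j⟩, rfl⟩
      refine Submodule.subset_span ⟨(i + 1, j), ?_⟩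
      simp [monomial, pow_succ', mul_assoc]
    exact this hs
  have hy : ∀ s ∈ S, y q * s ∈ S := by
    intro s hs
    have : S ≤ S.comap (LinearMap.mulLeft ℂ (y q)) := by
      rw [hS, Submodule.span_le]
      rintro _ ⟨⟨i, j⟩, rfl⟩
      have : y q * monomial q (i, j) = q.toC⁻¹ ^ i • monomial q (i, j + 1) := by
        rw [monomial, ← mul_assoc, y_mul_pow, smul_mul_assoc, mul_assoc, ← pow_succ']
        rfl
      change y q * monomial q (i, j) ∈ S
      rw [this]
      exact S.smul_mem _ (Submodule.subset_span ⟨_, rfl⟩)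
    exact this hs
  have key : ∀ p : FreeAlgebra ℂ (Fin 2), ∀ s ∈ S, mk q p * s ∈ S := by
    intro p
    induction p with
    | grade0 z =>
      intro s hs
      rw [AlgHom.commutes, ← Algebra.smul_def]
      exact S.smul_mem _ hs
    | grade1 g =>
      fin_cases g
      · exact hx
      · exact hy
    | mul a b ha hb =>
      intro s hs
      rw [map_mul, mul_assoc]
      exact ha _ (hb _ hs)
    | add a b ha hb =>
      intro s hs
      rw [map_add, add_mul]
      exact S.add_mem (ha _ hs) (hb _ hs)
  intro p _
  obtain ⟨p, rfl⟩ := RingQuot.mkAlgHom_surjective ℂ (QPlaneRel q) p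
  have h1 : (1 : QPlane q) ∈ S := Submodule.subset_span ⟨(0, 0), by simp [monomial]⟩
  exact mul_one (mk q p) ▸ key p 1 h1

/-- The basis of ordered monomials `x^i y^j` of the quantum plane. -/
def basis (q : QParam) : Module.Basis (ℕ × ℕ) ℂ (QPlane q) :=
  Module.Basis.mk (linearIndependent_monomial q) (span_monomial q)

lemma coaction_rel (q : QParam) :
    (x q ⊗ₜ[ℂ] QSU2.gen q .a + y q ⊗ₜ[ℂ] QSU2.gen q .c) *
        (x q ⊗ₜ[ℂ] QSU2.gen q .b + y q ⊗ₜ[ℂ] QSU2.gen q .d) =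
      q.toC • ((x q ⊗ₜ[ℂ] QSU2.gen q .b + y q ⊗ₜ[ℂ] QSU2.gen q .d) *
        (x q ⊗ₜ[ℂ] QSU2.gen q .a + y q ⊗ₜ[ℂ] QSU2.gen q .c)) := by
  have h := QSU2.gen_rel q
  have had : QSU2.gen q .a * QSU2.gen q .d = 1 + q.toC • (QSU2.gen q .b * QSU2.gen q .c) :=
    sub_eq_iff_eq_add.1 h.ad
  have hda : QSU2.gen q .d * QSU2.gen q .a = 1 + q.toC⁻¹ • (QSU2.gen q .b * QSU2.gen q .c) :=
    sub_eq_iff_eq_add.1 h.da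
  simp only [add_mul, mul_add, Algebra.TensorProduct.tmul_mul_tmul, h.ab, h.cd, ← h.bc, had, hda,
    x_mul_y, TensorProduct.tmul_add, TensorProduct.tmul_smul, TensorProduct.smul_tmul', smul_add,
    smul_smul, mul_inv_cancel₀ q.toC_ne_zero, one_smul]
  abel

/-- The right coaction of `SU_q(2)` on the quantum plane: the algebra homomorphism with
`R(x) = x ⊗ a + y ⊗ c` and `R(y) = x ⊗ b + y ⊗ d`. -/
def coaction (q : QParam) : QPlane q →ₐ[ℂ] QPlane q ⊗[ℂ] QSU2 q :=
  lift (x q ⊗ₜ[ℂ] QSU2.gen q .a + y q ⊗ₜ[ℂ] QSU2.gen q .c)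
    (x q ⊗ₜ[ℂ] QSU2.gen q .b + y q ⊗ₜ[ℂ] QSU2.gen q .d) (coaction_rel q)

/-- The Gaussian integer `1 + p + ⋯ + p^{n-1}`. -/
def gaussNat (p : ℝ) (n : ℕ) : ℝ := ∑ i ∈ Finset.range n, p ^ i

/-- The Gaussian factorial. -/
def gaussFactorial (p : ℝ) (n : ℕ) : ℝ := ∏ i ∈ Finset.range n, gaussNat p (i + 1)

/-- The Gaussian binomial coefficient, for `s ≤ k`. -/
def gaussBinom (p : ℝ) (k s : ℕ) : ℝ :=
  gaussFactorial p k / (gaussFactorial p s * gaussFactorial p (k - s))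

/-- The normalization factor of the vector `N_s x^{k-s} y^s` of the orthonormal basis of the
homogeneous polynomials of degree `k`, the square root of a Gaussian binomial coefficient in base
`q^{-2}`. -/
def normFactor (q : QParam) (k s : ℕ) : ℝ := √(gaussBinom ((q : ℝ) ^ 2)⁻¹ k s)

end QPlane

namespace QSU2

/-- The matrix coefficient `t^l_{rs}` of the irreducible corepresentation `T^l` with `k = 2l`. The
corepresentation is the restriction of the coaction to the homogeneous polynomials of degree `k` in
the basis `f_s = N_s x^{k-s} y^s`, `0 ≤ s ≤ k`, so that `R(f_s) = ∑_r f_r ⊗ t_{rs}`. The index `r`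
stands for the half-integer `r - l`. -/
def t (q : QParam) (k : ℕ) : Matrix (Fin (k + 1)) (Fin (k + 1)) (QSU2 q) := fun r s =>
  ((QPlane.normFactor q k s / QPlane.normFactor q k r : ℝ) : ℂ) •
    TensorProduct.equivFinsuppOfBasisLeft (QPlane.basis q)
      (QPlane.coaction q (QPlane.monomial q (k - s, s))) (k - r, r)

end QSU2

/-! ### Fourier transform, symbols and global pseudo-differential operators

Half-integers `l` are encoded by the natural number `k = 2l`, and a matrix index `i : Fin (k + 1)`
stands for the half-integer `i - l`. -/

namespace QSU2

/-- The `q`-number `[n]_q = (q^n - q^{-n}) / (q - q⁻¹)`. -/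
def qNum (q : QParam) (n : ℕ) : ℝ :=
  ((q : ℝ) ^ n - ((q : ℝ) ^ n)⁻¹) / ((q : ℝ) - (q : ℝ)⁻¹)

/-- The Fourier transform `f̂(l)_{mn} = h(f (t^l_{nm})*) = ⟨t^l_{nm}, f⟩`, with `k = 2l`. -/
def fourier {q : QParam} (f : Hilb q) (k : ℕ) : Matrix (Fin (k + 1)) (Fin (k + 1)) ℂ :=
  fun m n => inner ℂ (t q k n m : Hilb q) f

lemma fourier_coe {q : QParam} (f : QSU2 q) (k : ℕ) (m n : Fin (k + 1)) :
    fourier (f : Hilb q) k m n = haar q (f * star (t q k n m)) := by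
  rw [fourier, UniformSpace.Completion.inner_coe, inner_eq]

/-- A symbol: for every half-integer `l` a `(2l+1) × (2l+1)` matrix with entries in the completion
`L²(SU_q(2))`. -/
abbrev Symbol (q : QParam) : Type := ∀ k : ℕ, Matrix (Fin (k + 1)) (Fin (k + 1)) (Hilb q)

/-- The summand `[2l+1]_q Tr(σ(l) f̂(l) T^l)`, with `k = 2l`, of the series defining `T_σ f`. -/
def symbolTerm {q : QParam} (σ : Symbol q) (f : Hilb q) (k : ℕ) : Hilb q :=
  (qNum q (k + 1) : ℂ) •
    ∑ i, ∑ j, ∑ p, fourier f k j p • rmul (t q k p i) (σ k i j)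

lemma symbolTerm_add {q : QParam} (σ : Symbol q) (f g : Hilb q) :
    symbolTerm σ (f + g) = fun k => symbolTerm σ f k + symbolTerm σ g k := by
  funext k
  simp only [symbolTerm, fourier, inner_add_right, add_smul, Finset.sum_add_distrib, smul_add]

lemma symbolTerm_smul {q : QParam} (σ : Symbol q) (z : ℂ) (f : Hilb q) :
    symbolTerm σ (z • f) = fun k => z • symbolTerm σ f k := by
  funext k
  simp only [symbolTerm, fourier, inner_smul_right, Finset.smul_sum, smul_smul, mul_left_comm]

/-- The global pseudo-differential operator `T_σ f = ∑_l [2l+1]_q Tr(σ(l) f̂(l) T^l)`, defined for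
those `f` in `L²(SU_q(2))` for which the partial sums of the series converge in norm. -/
def pdo {q : QParam} (σ : Symbol q) : Hilb q →ₗ.[ℂ] Hilb q where
  domain :=
    { carrier := {f | Summable (symbolTerm σ f) (.conditional ℕ)}
      add_mem' := fun {f g} hf hg => by
        rw [Set.mem_ofPred_eq, symbolTerm_add]
        exact Summable.add hf hg
      zero_mem' := by
        have h : symbolTerm σ (0 : Hilb q) = fun _ => 0 := by
          funext k
          simp [symbolTerm, fourier]
        rw [Set.mem_ofPred_eq, h]
        exact summable_zero
      smul_mem' := fun z f hf => by
        rw [Set.mem_ofPred_eq, symbolTerm_smul]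
        exact Summable.const_smul z hf }
  toFun :=
    { toFun := fun f => ∑'[.conditional ℕ] k, symbolTerm σ f k
      map_add' := fun f g => by
        rw [Submodule.coe_add, symbolTerm_add]
        exact Summable.tsum_add f.2 g.2
      map_smul' := fun z f => by
        rw [Submodule.coe_smul, symbolTerm_smul]
        exact Summable.tsum_const_smul z f.2 }

/-- Twice the half-integer `i - l` which the index `i : Fin (k + 1)` stands for, where `k = 2l`. -/
def twiceIndex {k : ℕ} (i : Fin (k + 1)) : ℤ := 2 * (i : ℤ) - k

/-- Homogeneous symbols of Fourier order `m = M / 2 ≥ 0`: for every `l` there is an index map `ψ(l)`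
such that `σ(l)_{ij}` is a multiple of `t^m_{ψ(l)(i,j)}`, and `σ(l)_{ij} = 0` if `ψ(l)(i,j)` is not
a pair of indices of `T^m`. The values of `ψ` are pairs of half-integers, encoded by their
doubles. -/
def IsHomogeneous {q : QParam} (M : ℕ) (σ : Symbol q) : Prop :=
  ∀ k : ℕ, ∃ ψ : Fin (k + 1) × Fin (k + 1) → ℤ × ℤ, ∀ i j : Fin (k + 1),
    (∀ r s : Fin (M + 1), ψ (i, j) = (twiceIndex r, twiceIndex s) →
      σ k i j ∈ Submodule.span ℂ {(t q M r s : Hilb q)}) ∧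
    ((¬ ∃ r s : Fin (M + 1), ψ (i, j) = (twiceIndex r, twiceIndex s)) → σ k i j = 0)

/-- `B ∘ A = Id` on the coordinate algebra, all the expressions involved being defined. -/
def CompEqId {q : QParam} (B A : Hilb q →ₗ.[ℂ] Hilb q) : Prop :=
  ∀ f : QSU2 q, ∃ (h : (f : Hilb q) ∈ A.domain) (h' : A ⟨f, h⟩ ∈ B.domain), B ⟨A ⟨f, h⟩, h'⟩ = f

/-- Homogeneous symbols of negative Fourier order `-M / 2`: the operator is inverse to the operator
of a homogeneous symbol of order `M / 2`. -/
def IsHomogeneousNeg {q : QParam} (M : ℕ) (σ : Symbol q) : Prop :=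
  ∃ β : Symbol q, IsHomogeneous M β ∧ CompEqId (pdo β) (pdo σ) ∧ CompEqId (pdo σ) (pdo β)

/-- The class `Φ^{M/2}(SU_q(2))` of symbols of Fourier order `M / 2`, for an integer `M`: the finite
linear combinations of homogeneous symbols of that order. -/
def symbolClass (q : QParam) : ℤ → Submodule ℂ (Symbol q)
  | .ofNat M => Submodule.span ℂ {σ | IsHomogeneous M σ}
  | .negSucc M => Submodule.span ℂ {σ | IsHomogeneousNeg (M + 1) σ}

end QSU2

end

namespace QSU2

variable {q : QParam} {σ : Symbol q} {s : Finset ℕ}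

/-- The linear map `A ↦ [2l+1]_q Tr(σ(l) A T^l)` on scalar matrices, with `k = 2l`. The `l`-th
summand of `T_σ` factors through it, hence through a finite-dimensional space. -/
noncomputable def symbolTrace (σ : Symbol q) (k : ℕ) :
    Matrix (Fin (k + 1)) (Fin (k + 1)) ℂ →ₗ[ℂ] Hilb q :=
  (qNum q (k + 1) : ℂ) • ∑ i, ∑ j, ∑ p,
    (Matrix.entryLinearMap ℂ ℂ j p).smulRight (rmul (t q k p i) (σ k i j))

lemma symbolTrace_fourier (σ : Symbol q) (f : Hilb q) (k : ℕ) :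
    symbolTrace σ k (fourier f k) = symbolTerm σ f k := by
  simp [symbolTrace, symbolTerm]

lemma continuous_fourier (q : QParam) (k : ℕ) : Continuous fun f : Hilb q => fourier f k :=
  continuous_matrix fun _ _ => continuous_const.inner continuous_id

lemma continuous_symbolTerm (σ : Symbol q) (k : ℕ) :
    Continuous fun f : Hilb q => symbolTerm σ f k := by
  have h_comp : Continuous fun f : Hilb q => symbolTrace σ k (fourier f k) :=
    (symbolTrace σ k).continuous_of_finiteDimensional.comp (continuous_fourier q k)
  exact h_comp.congr fun f => symbolTrace_fourier σ f k

lemma hasSum_symbolTerm (hσ : ∀ k ∉ s, σ k = 0) (f : Hilb q) :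
    HasSum (symbolTerm σ f) (∑ k ∈ s, symbolTerm σ f k) (.conditional ℕ) :=
  hasSum_sum_of_ne_finset_zero fun k hk => by simp [symbolTerm, hσ k hk]

lemma pdo_domain_eq_top (hσ : ∀ k ∉ s, σ k = 0) : (pdo σ).domain = ⊤ :=
  eq_top_iff.2 fun f _ => (hasSum_symbolTerm hσ f).summable

lemma pdo_apply_eq_sum (hσ : ∀ k ∉ s, σ k = 0) (f : (pdo σ).domain) :
    pdo σ f = ∑ k ∈ s, symbolTerm σ f k :=
  (hasSum_symbolTerm hσ (f : Hilb q)).tsum_eq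

lemma continuous_pdo (hσ : ∀ k ∉ s, σ k = 0) :
    Continuous fun f : (pdo σ).domain => pdo σ f := by
  simp only [pdo_apply_eq_sum hσ]
  exact continuous_finsetSum s fun k _ =>
    (continuous_symbolTerm σ k).comp continuous_subtype_val

lemma range_pdo_le_sup_range_symbolTrace (hσ : ∀ k ∉ s, σ k = 0) :
    LinearMap.range (pdo σ).toFun ≤ s.sup fun k => LinearMap.range (symbolTrace σ k) := by
  rintro _ ⟨f, rfl⟩
  rw [LinearPMap.toFun_eq_coe, pdo_apply_eq_sum hσ]
  refine Submodule.sum_mem _ fun k hk => ?_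
  rw [← symbolTrace_fourier]
  exact Finset.le_sup (f := fun k => LinearMap.range (symbolTrace σ k)) hk
    (LinearMap.mem_range_self _ _)

lemma finiteDimensional_range_pdo (hσ : ∀ k ∉ s, σ k = 0) :
    FiniteDimensional ℂ (LinearMap.range (pdo σ).toFun) :=
  Submodule.finiteDimensional_of_le (range_pdo_le_sup_range_symbolTrace hσ)

end QSU2

theorem mainTheorem12_general (q : QParam) (σ : QSU2.Symbol q) (hσ : {k | σ k ≠ 0}.Finite) :
    (QSU2.pdo σ).domain = ⊤ ∧
      (Continuous fun f : (QSU2.pdo σ).domain => QSU2.pdo σ f) ∧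
      FiniteDimensional ℂ (LinearMap.range (QSU2.pdo σ).toFun) := by
  have hσ' : ∀ k ∉ hσ.toFinset, σ k = 0 := by simp
  exact ⟨QSU2.pdo_domain_eq_top hσ', QSU2.continuous_pdo hσ', QSU2.finiteDimensional_range_pdo hσ'⟩

theorem mainTheorem12 (q : QParam) (M : ℤ) (σ : QSU2.Symbol q) (hσ : σ ∈ QSU2.symbolClass q M)
    (N : ℕ) (hN : ∀ k : ℕ, 2 * N < k → σ k = 0) :
    (QSU2.pdo σ).domain = ⊤ ∧
      (Continuous fun f : (QSU2.pdo σ).domain => QSU2.pdo σ f) ∧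
      FiniteDimensional ℂ (LinearMap.range (QSU2.pdo σ).toFun) :=
  mainTheorem12_general q σ <|
    (Set.finite_le_nat (2 * N)).subset fun k hk => not_lt.1 (mt (hN k) hk)
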